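/- **Model.** Consider a zero-padded OFDM link with $n_x\ge1$ data samples and $n_z$ padded zeros per symbol, $n_s=n_x+n_z$ samples per symbol, and a channel with $n_h$ taps, $1\le n_h\le n_z$ (no inter-symbol interference). Let $\sigma_x,\sigma_w,\sigma_{h_0},\dots,\sigma_{h_{n_h-1}}>0$; $\mathcal{CN}(0,\sigma^2)$ denotes the circularly symmetric complex Gaussian law of variance $\sigma^2$. The transmitted samples are $s_n[k]=x_n[k]$ for $0\le k\le n_x-1$ and $s_n[k]=0$ for $n_x\le k\le n_s-1$, $n=0,1,2,\dots$, where the $x_n[k]$ are i.i.d. $\mathcal{CN}(0,\sigma_x^2)$; nothing is transmitted before time $0$. Thus the transmitted stream is $\tilde s[nn_s+k]=s_n[k]$ for $n\ge0$, $0\le k\le n_s-1$, and $\tilde s[u]=0$ for $u<0$, and the channel output at time $u\in\mathbb Z$ is $$\tilde y[u]=\sum_{l=0}^{n_h-1}h[u;l]\,\tilde s[u-l]+w[u],$$ where at each time $u$ the taps $h[u;l]\sim\mathcal{CN}(0,\sigma_{h_l}^2)$, $0\le l\le n_h-1$, are independent (their dependence in time is arbitrary), the noise samples $w[u]$ are i.i.d.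 $\mathcal{CN}(0,\sigma_w^2)$, and the channel, the data and the noise are independent of each other. With integer timing offset $d$ the receiver observes $y_n[m]=\tilde y[nn_s+m+d]$, $n\in\mathbb Z$, $0\le m\le n_s-1$. The hypothesis $\mathrm H_0$ is $d=0$; then, for $n\ge0$, $y_n[m]=\sum_{l=0}^{n_h-1}h[nn_s+m;l]\,s_n[m-l]+w[nn_s+m]$, with $s_n[k]=0$ for $k<0$. **Theorem.** Under $\mathrm H_0$: (1) If $n<0$ and $0\le m\le n_s-1$, or if $n\ge0$ and $n_x+n_h-1\le m\le n_s-1$, then the in-phase component $\Re\, y_n[m]$ and the quadrature component $\Im\, y_n[m]$ each have the probability density $$f(y)=\frac1{\sqrt{\pi\sigma_w^2}}\exp\Big(-\frac{y^2}{\sigma_w^2}\Big).$$ (2) Let $n\ge0$ and $0\le m\le n_x+n_h-2$. Put $a=0$ if $m\le n_x-1$ and $a=m-n_x+1$ if $m\ge n_x$; put $b=m$ if $m\le n_h-2$ and $b=n_h-1$ if $m\ge n_h-1$. Let $\lambda_k=2/(\sigma_{h_k}\sigma_x)$ and assume that $\lambda_a,\dots,\lambda_b$ are pairwise distinct. Then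 $\Re\, y_n[m]$ and $\Im\, y_n[m]$ each have the probability density $$f(y)=\Big(\prod_{i=a}^b\lambda_i\Big)^2\sum_{j=a}^b\sum_{r=a}^b\frac{e^{(\lambda_j\sigma_w/2)^2}}{\prod_{k=a,\,k\ne j}^b(\lambda_k-\lambda_j)}\cdot\frac1{\prod_{u=a,\,u\ne r}^b(\lambda_u-\lambda_r)}\cdot\frac1{\lambda_j+\lambda_r}\cdot\frac12\Big[e^{-\lambda_jy}\Big(1-\Phi\Big(\frac{\lambda_j\sigma_w}2-\frac y{\sigma_w}\Big)\Big)+e^{\lambda_jy}\Big(1-\Phi\Big(\frac{\lambda_j\sigma_w}2+\frac y{\sigma_w}\Big)\Big)\Big],$$ where $\Phi(x)=\frac2{\sqrt\pi}\int_0^xe^{-t^2}\,dt$, and this $f$ satisfies $f(-y)=f(y)$ for all $y\in\mathbb R$. -/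

import Mathlib

open MeasureTheory ProbabilityTheory
open scoped NNReal ENNReal

noncomputable section

namespace ZPOFDM

/-- The circularly symmetric complex Gaussian law `CN(0, σ²)`: real and imaginary parts are
independent, centred real Gaussians of variance `σ² / 2`. -/
def complexGaussian (σ : ℝ) : Measure ℂ :=
  ((gaussianReal 0 (σ ^ 2 / 2).toNNReal).prod (gaussianReal 0 (σ ^ 2 / 2).toNNReal)).map
    (fun p : ℝ × ℝ => (⟨p.1, p.2⟩ : ℂ))

/-- The random objects of a zero-padded OFDM link with `nx` data samples per symbol and `nh`
channel taps: `h u l` is the (possibly time-varying) `l`-th channel tap at sampling time `u`,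
`x n k` is the `k`-th time-domain sample `x_n(k T_sa)` of the `n`-th OFDM symbol, `n ≥ 0`, and
`w u` is the receiver noise at sampling time `u`. -/
structure Link (Ω : Type*) (nx nh : ℕ) where
  h : ℤ → Fin nh → Ω → ℂ
  x : ℕ → Fin nx → Ω → ℂ
  w : ℤ → Ω → ℂ

/-- The statistical model: Rayleigh fading with uncorrelated scattering and delay profile
`(σh l)²`, independent and identically distributed `CN(0, σx²)` OFDM samples, white Gaussian noise
`CN(0, σw²)`; channel, data and noise are independent. Nothing is assumed about the correlation of
the channel in time. -/
structure Link.IsRayleigh {Ω : Type*} [MeasurableSpace Ω] {nx nh : ℕ} (L : Link Ω nx nh)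
    (P : Measure Ω) (σh : ℕ → ℝ) (σx σw : ℝ) : Prop where
  measurable_h : ∀ u l, Measurable (L.h u l)
  measurable_x : ∀ n k, Measurable (L.x n k)
  measurable_w : ∀ u, Measurable (L.w u)
  law_h : ∀ u (l : Fin nh), HasLaw (L.h u l) (complexGaussian (σh l)) P
  law_x : ∀ n k, HasLaw (L.x n k) (complexGaussian σx) P
  law_w : ∀ u, HasLaw (L.w u) (complexGaussian σw) P
  indep_taps : ∀ u, iIndepFun (fun l : Fin nh => L.h u l) P
  indep_samples : iIndepFun (fun p : ℕ × Fin nx => L.x p.1 p.2) P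
  indep_noise : iIndepFun L.w P
  indep_channel_data :
    IndepFun (fun ω (u : ℤ) (l : Fin nh) => L.h u l ω) (fun ω n k => L.x n k ω) P
  indep_signal_noise :
    IndepFun (fun ω => ((fun (u : ℤ) (l : Fin nh) => L.h u l ω), (fun n k => L.x n k ω)))
      (fun ω u => L.w u ω) P

/-- The `m`-th sample `s_n[m]` of the zero-padded symbol `n`. -/
def Link.symbol {Ω : Type*} {nx nh : ℕ} (L : Link Ω nx nh) (n m : ℕ) (ω : Ω) : ℂ :=
  if hm : m < nx then L.x n ⟨m, hm⟩ ω else 0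

/-- The transmitted stream `…, 0, 0, s_0[0], …, s_0[ns - 1], s_1[0], …` with `ns = nx + nz` samples
per symbol; nothing is transmitted before time `0`. -/
def Link.sent {Ω : Type*} {nx nh : ℕ} (L : Link Ω nx nh) (nz : ℕ) (u : ℤ) (ω : Ω) : ℂ :=
  if 0 ≤ u then
    L.symbol (u / ((nx + nz : ℕ) : ℤ)).toNat (u % ((nx + nz : ℕ) : ℤ)).toNat ω
  else 0

/-- The channel output at sampling time `u`. -/
def Link.output {Ω : Type*} {nx nh : ℕ} (L : Link Ω nx nh) (nz : ℕ) (u : ℤ) (ω : Ω) : ℂ :=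
  ∑ l : Fin nh, L.h u l ω * L.sent nz (u - ((l : ℕ) : ℤ)) ω + L.w u ω

/-- The `m`-th sample `y_n[m]` of the `n`-th observation vector when the integer timing offset is
`d`: the receiver's window is shifted by `d` samples. The hypothesis `H_0` is `d = 0`; `n < 0` means
observing before the transmission starts. -/
def Link.received {Ω : Type*} {nx nh : ℕ} (L : Link Ω nx nh) (nz : ℕ) (d n : ℤ) (m : ℕ)
    (ω : Ω) : ℂ :=
  L.output nz (n * ((nx + nz : ℕ) : ℤ) + (m : ℤ) + d) ω

/-- The real random variable `X` has the probability density function `f ≥ 0` with respect to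
Lebesgue measure. -/
def HasDensity {Ω : Type*} [MeasurableSpace Ω] (P : Measure Ω) (X : Ω → ℝ) (f : ℝ → ℝ) : Prop :=
  (∀ y, 0 ≤ f y) ∧ HasPDF X P volume ∧ pdf X P volume =ᵐ[volume] fun y => ENNReal.ofReal (f y)

/-- The Gaussian error function. -/
def erf (x : ℝ) : ℝ := 2 / √Real.pi * ∫ t in (0 : ℝ)..x, Real.exp (-t ^ 2)

/-- The rates `λ_k = 2 / (σ_{h_k} σ_x)`. -/
def rate (σh : ℕ → ℝ) (σx : ℝ) (k : ℕ) : ℝ := 2 / (σh k * σx)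

/-- The first channel tap `a` that contributes to sample `m`: `0` for `m ≤ nx - 1` and `m - nx + 1`
for `m ≥ nx`. -/
def firstTap (nx m : ℕ) : ℕ := if m < nx then 0 else m - nx + 1

/-- The last channel tap `b` that contributes to sample `m`: `m` for `m ≤ nh - 2` and `nh - 1` for
`m ≥ nh - 1`. -/
def lastTap (nh m : ℕ) : ℕ := if m + 2 ≤ nh then m else nh - 1

/-- The density in noise-only positions. -/
def noiseDensity (σw : ℝ) (y : ℝ) : ℝ :=
  1 / √(Real.pi * σw ^ 2) * Real.exp (-(y ^ 2 / σw ^ 2))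

/-- The closed-form density with rates `lam k`, `a ≤ k ≤ b`. -/
def signalDensity (lam : ℕ → ℝ) (σw : ℝ) (a b : ℕ) (y : ℝ) : ℝ :=
  (∏ i ∈ Finset.Icc a b, lam i) ^ 2 *
    ∑ j ∈ Finset.Icc a b, ∑ n ∈ Finset.Icc a b,
      Real.exp ((lam j * σw / 2) ^ 2) / (∏ k ∈ (Finset.Icc a b).erase j, (lam k - lam j)) *
      (1 / ∏ u ∈ (Finset.Icc a b).erase n, (lam u - lam n)) *
      (1 / (lam j + lam n)) *
      (1 / 2 *
        (Real.exp (-(lam j * y)) * (1 - erf (lam j * σw / 2 - y / σw)) +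
         Real.exp (lam j * y) * (1 - erf (lam j * σw / 2 + y / σw))))

end ZPOFDM

end

namespace ZPOFDM

/-! ### Partial fractions -/

/-! Everything is done with characteristic functions. Only one sampling time enters, so the time
correlation of the channel plays no role. The zero padding makes each tap `l` meet either a zero or
the data sample `m - l` of the current symbol, so the output is a sum of independent products of
complex Gaussians plus independent noise.

Given `h`, the product `h * x` is again circular Gaussian with variance proportional to `‖h‖ ^ 2`;
averaging over `h` gives the characteristic function `(1 + (σh * σx / 2) ^ 2 * ‖z‖ ^ 2)⁻¹`
(`integral_integral_exp_inner_mul`). It depends on `‖z‖` only, so real and imaginary parts have the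
same law, and on a line it is that of a Laplace law with rate `λ = 2 / (σh * σx)`. Without
contributing taps only the Gaussian factor of the noise remains.

Otherwise, partial fractions in `t ^ 2`, available because the rates are distinct, turn the product
of Laplace factors into a linear combination of single ones (`sum_laplaceWeight_mul`). Each of
these, times the noise factor, is the transform of an explicit Laplace-Gaussian convolution
(`charFun_laplaceGaussian`). A second use of partial fractions matches the weights with the double
sum of the closed form (`signalDensity_eq_sum`). The weights may be negative, so nonnegativity of
the sum is not termwise; it is deduced from its transform being that of a measure
(`eq_withDensity_of_charFun_eq`). -/

theorem prod_inv_add_eq_sum {ι : Type*} [DecidableEq ι] {s : Finset ι} (hs : s.Nonempty)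
    {v : ι → ℝ} (hv : Set.InjOn v s) {x : ℝ} (hx : ∀ i ∈ s, v i + x ≠ 0) :
    ∏ i ∈ s, (v i + x)⁻¹ =
      ∑ j ∈ s, (∏ k ∈ s.erase j, (v k - v j)⁻¹) * (v j + x)⁻¹ := by
  -- The Lagrange basis polynomials with nodes `v i` sum to `1`; evaluating at `-x` and dividing by
  -- `∏ (v i + x)` is the partial fraction expansion.
  have h := congrArg (Polynomial.eval (-x)) (Lagrange.sum_basis hv hs)
  simp only [Polynomial.eval_finsetSum, Polynomial.eval_one] at h
  rw [← one_mul (∏ i ∈ s, (v i + x)⁻¹), ← h, Finset.sum_mul]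
  refine Finset.sum_congr rfl fun j hj => ?_
  rw [← Finset.mul_prod_erase s _ hj, Lagrange.basis, Polynomial.eval_prod,
    mul_left_comm, ← Finset.prod_mul_distrib, mul_comm]
  congr 1
  refine Finset.prod_congr rfl fun k hk => ?_
  obtain ⟨hkj, hks⟩ := Finset.mem_erase.1 hk
  have h1 : v j - v k ≠ 0 := sub_ne_zero.2 fun h => hkj (hv hks hj h.symm)
  have h2 : v k - v j ≠ 0 := sub_ne_zero.2 fun h => hkj (hv hks hj h)
  have h3 := hx k hks
  simp only [Lagrange.basisDivisor, Polynomial.eval_mul, Polynomial.eval_C, Polynomial.eval_sub,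
    Polynomial.eval_X]
  field_simp
  ring

/-! ### Densities from characteristic functions -/

theorem charFun_withDensity_ofReal {f : ℝ → ℝ} (hf : Measurable f) (h0 : ∀ y, 0 ≤ f y) (t : ℝ) :
    charFun (volume.withDensity fun y => ENNReal.ofReal (f y)) t =
      ∫ y, (f y : ℂ) * Complex.exp (t * y * Complex.I) := by
  rw [charFun_apply_real, integral_withDensity_eq_integral_toReal_smul (by fun_prop) (by simp)]
  refine integral_congr_ae (.of_forall fun y => ?_)
  simp [ENNReal.toReal_ofReal (h0 y)]

theorem Integrable.mul_exp_I {f : ℝ → ℝ} (hf : Integrable f) (t : ℝ) :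
    Integrable fun y => (f y : ℂ) * Complex.exp (t * y * Complex.I) := by
  refine hf.ofReal.mul_bdd (c := 1) (by fun_prop) (.of_forall fun y => ?_)
  rw [← Complex.ofReal_mul, Complex.norm_exp_ofReal_mul_I]

theorem isFiniteMeasure_withDensity_of_integrable {f : ℝ → ℝ} (hf : Integrable f) :
    IsFiniteMeasure (volume.withDensity fun y => ENNReal.ofReal (f y)) :=
  isFiniteMeasure_withDensity_ofReal hf.2

/-- A continuous integrable function whose Fourier transform is the characteristic function of a
finite measure is a nonnegative density of that measure. -/
theorem eq_withDensity_of_charFun_eq {μ : Measure ℝ} [IsFiniteMeasure μ] {f : ℝ → ℝ}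
    (hc : Continuous f) (hi : Integrable f)
    (h : ∀ t, charFun μ t = ∫ y, (f y : ℂ) * Complex.exp (t * y * Complex.I)) :
    (∀ y, 0 ≤ f y) ∧ μ = volume.withDensity fun y => ENNReal.ofReal (f y) := by
  have hpi : Integrable fun y => max (f y) 0 := hi.pos_part
  have hni : Integrable fun y => max (-f y) 0 := hi.neg_part
  have := isFiniteMeasure_withDensity_of_integrable hpi
  have := isFiniteMeasure_withDensity_of_integrable hni
  set p := volume.withDensity fun y => ENNReal.ofReal (max (f y) 0)
  set q := volume.withDensity fun y => ENNReal.ofReal (max (-f y) 0)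
  -- Moving the negative part of `f` to the other side keeps all measures positive, so uniqueness of
  -- characteristic functions of finite measures applies without signed measures.
  have hpq : μ + q = p := by
    refine Measure.ext_of_charFun (funext fun t => ?_)
    have hadd : charFun (μ + q) t = charFun μ t + charFun q t := by
      have hint : ∀ (ν : Measure ℝ) [IsFiniteMeasure ν],
          Integrable (fun y : ℝ => Complex.exp (t * y * Complex.I)) ν := fun ν _ => by
        refine Integrable.of_bound (by fun_prop) 1 (.of_forall fun y => ?_)
        rw [← Complex.ofReal_mul, Complex.norm_exp_ofReal_mul_I]
      simp only [charFun_apply_real]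
      exact integral_add_measure (hint μ) (hint q)
    rw [hadd, h, charFun_withDensity_ofReal (by fun_prop) (fun y => le_max_right _ _),
      charFun_withDensity_ofReal (by fun_prop) (fun y => le_max_right _ _),
      ← integral_add (Integrable.mul_exp_I hi t) (Integrable.mul_exp_I hni t)]
    congr 1 with y
    rw [← add_mul, ← Complex.ofReal_add]
    congr 2
    rcases le_total 0 (f y) with h | h
    · simp [h]
    · simp [h]
  -- From `μ + q = p` follows `q ≤ p`, so the negative part is a.e. at most the positive part. As
  -- one of them always vanishes, `f ≥ 0` a.e., and continuity makes this hold everywhere.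
  have hae : (fun y => ENNReal.ofReal (max (-f y) 0)) ≤ᵐ[volume]
      fun y => ENNReal.ofReal (max (f y) 0) := by
    refine ae_le_of_forall_setLIntegral_le_of_sigmaFinite (by fun_prop) fun s hs _ => ?_
    rw [← withDensity_apply _ hs, ← withDensity_apply _ hs]
    change q s ≤ p s
    rw [← hpq]
    simp
  have hnn : ∀ y, 0 ≤ f y := by
    have h1 : (fun y => max (f y) 0) =ᵐ[volume] f := by
      filter_upwards [hae] with y hy
      rw [ENNReal.ofReal_le_ofReal_iff (le_max_right _ _)] at hy
      rcases le_total 0 (f y) with h | h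
      · simp [h]
      · rw [max_eq_left (by linarith), max_eq_right h] at hy
        rw [max_eq_right h]; linarith
    have h2 := ((hc.max continuous_const).ae_eq_iff_eq volume hc).1 h1
    exact fun y => by rw [← h2]; exact le_max_right _ _
  refine ⟨hnn, ?_⟩
  have hq : q = 0 := by
    have : (fun y => ENNReal.ofReal (max (-f y) 0)) = 0 := by
      ext y; simp [hnn y]
    simp only [q, this, withDensity_zero]
  have hp : p = volume.withDensity fun y => ENNReal.ofReal (f y) := by
    simp only [p, max_eq_left (hnn _)]
  rw [← hp, ← hpq, hq, add_zero]

theorem hasDensity_of_map_eq {Ω : Type*} [MeasurableSpace Ω] {P : Measure Ω} [IsFiniteMeasure P]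
    {X : Ω → ℝ} (hX : Measurable X) {f : ℝ → ℝ} (hf : Measurable f) (h0 : ∀ y, 0 ≤ f y)
    (h : P.map X = volume.withDensity fun y => ENNReal.ofReal (f y)) : HasDensity P X f := by
  refine ⟨h0, hasPDF_of_map_eq_withDensity hX.aemeasurable _ (by fun_prop) h, ?_⟩
  rw [pdf, h]
  exact Measure.rnDeriv_withDensity _ (by fun_prop)

/-! ### The Laplace law convolved with a Gaussian -/

theorem integral_Ioi_exp_neg_sq (c : ℝ) :
    ∫ v in Set.Ioi c, Real.exp (-v ^ 2) = √Real.pi / 2 * (1 - erf c) := by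
  have hi : Integrable fun v : ℝ => Real.exp (-v ^ 2) := by
    simpa using integrable_exp_neg_mul_sq one_pos
  have h0 : ∫ v in Set.Ioi (0 : ℝ), Real.exp (-v ^ 2) = √Real.pi / 2 := by
    simpa using integral_gaussian_Ioi 1
  have h1 := intervalIntegral.integral_Ioi_sub_Ioi' (a := 0) (b := c) hi.integrableOn
    hi.integrableOn
  have hpi : √Real.pi ≠ 0 := by positivity
  rw [erf, ← h1, h0]
  field_simp
  ring

theorem integral_Ioi_exp_mul_gaussian (l x : ℝ) {σ : ℝ} (hσ : 0 < σ) :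
    ∫ u in Set.Ioi (0 : ℝ), Real.exp (-(l * u)) *
        gaussianPDFReal 0 (σ ^ 2 / 2).toNNReal (-u + x) =
      Real.exp ((l * σ / 2) ^ 2) * (1 / 2 * (Real.exp (-(l * x)) *
        (1 - erf (l * σ / 2 - x / σ)))) := by
  -- Complete the square in `u`; the variable `v = u / σ + (l * σ / 2 - x / σ)` then yields a
  -- Gaussian tail.
  have hpt : ∀ u : ℝ, Real.exp (-(l * u)) * gaussianPDFReal 0 (σ ^ 2 / 2).toNNReal (-u + x) =
      (√(Real.pi) * σ)⁻¹ * Real.exp ((l * σ / 2) ^ 2) * Real.exp (-(l * x)) *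
        Real.exp (-(u * σ⁻¹ + (l * σ / 2 - x / σ)) ^ 2) := fun u => by
    rw [gaussianPDFReal, Real.coe_toNNReal _ (by positivity),
      show 2 * Real.pi * (σ ^ 2 / 2) = Real.pi * σ ^ 2 by ring, Real.sqrt_mul Real.pi_nonneg,
      Real.sqrt_sq hσ.le, mul_left_comm, ← Real.exp_add, mul_assoc, mul_assoc, ← Real.exp_add,
      ← Real.exp_add]
    congr 2
    field_simp
    ring
  have hshift : ∀ c : ℝ, ∫ v in Set.Ioi (0 : ℝ), Real.exp (-(v + c) ^ 2) =
      ∫ v in Set.Ioi c, Real.exp (-v ^ 2) := fun c => by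
    have := (measurePreserving_add_right volume c).setIntegral_preimage_emb
      (measurableEmbedding_addRight c) (fun v => Real.exp (-v ^ 2)) (Set.Ioi c)
    simpa using this
  simp_rw [hpt]
  rw [integral_const_mul, integral_comp_mul_right_Ioi
    (fun v => Real.exp (-(v + (l * σ / 2 - x / σ)) ^ 2)) 0 (inv_pos.2 hσ), zero_mul, hshift,
    integral_Ioi_exp_neg_sq, inv_inv, smul_eq_mul]
  have hpi : √Real.pi ≠ 0 := by positivity
  field_simp

/-- The convolution of `u ↦ exp (-l |u|)` with the centred Gaussian density of variance
`σ² / 2`. -/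
noncomputable def laplaceGaussian (l σ y : ℝ) : ℝ :=
  Real.exp ((l * σ / 2) ^ 2) * (1 / 2 *
    (Real.exp (-(l * y)) * (1 - erf (l * σ / 2 - y / σ)) +
      Real.exp (l * y) * (1 - erf (l * σ / 2 + y / σ))))

theorem continuous_erf : Continuous erf := by
  unfold erf
  exact continuous_const.mul
    (intervalIntegral.continuous_primitive (fun a b => (by fun_prop : Continuous
      fun t : ℝ => Real.exp (-t ^ 2)).intervalIntegrable a b) 0)

theorem continuous_laplaceGaussian (l σ : ℝ) : Continuous (laplaceGaussian l σ) := by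
  have := continuous_erf
  unfold laplaceGaussian
  fun_prop

theorem integrable_exp_neg_abs_mul_gaussian {l : ℝ} (hl : 0 ≤ l) (v : ℝ≥0) (x : ℝ) :
    Integrable fun u => Real.exp (-(l * |u|)) * gaussianPDFReal 0 v (-u + x) := by
  refine Integrable.bdd_mul (c := 1) ?_ (by fun_prop) (.of_forall fun u => ?_)
  · have := (integrable_gaussianPDFReal 0 v).comp_sub_left x
    simpa [sub_eq_neg_add] using this
  · rw [Real.norm_of_nonneg (Real.exp_nonneg _), Real.exp_le_one_iff]
    have := mul_nonneg hl (abs_nonneg u)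
    linarith

theorem integral_exp_neg_abs_mul_gaussian {l σ : ℝ} (hl : 0 ≤ l) (hσ : 0 < σ) (x : ℝ) :
    ∫ u, Real.exp (-(l * |u|)) * gaussianPDFReal 0 (σ ^ 2 / 2).toNNReal (-u + x) =
      laplaceGaussian l σ x := by
  have hi := integrable_exp_neg_abs_mul_gaussian hl (σ ^ 2 / 2).toNNReal x
  have hpos : ∫ u in Set.Ioi (0 : ℝ), Real.exp (-(l * |u|)) *
      gaussianPDFReal 0 (σ ^ 2 / 2).toNNReal (-u + x) = ∫ u in Set.Ioi (0 : ℝ),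
      Real.exp (-(l * u)) * gaussianPDFReal 0 (σ ^ 2 / 2).toNNReal (-u + x) :=
    setIntegral_congr_fun measurableSet_Ioi fun u hu => by
      simp only [abs_of_pos (Set.mem_Ioi.1 hu)]
  -- Since the Gaussian is even, reflecting `u` turns the left half into the right half with `x`
  -- replaced by `-x`.
  have hneg : ∫ u in Set.Iic (0 : ℝ), Real.exp (-(l * |u|)) *
      gaussianPDFReal 0 (σ ^ 2 / 2).toNNReal (-u + x) = ∫ u in Set.Ioi (0 : ℝ),
      Real.exp (-(l * u)) * gaussianPDFReal 0 (σ ^ 2 / 2).toNNReal (-u + -x) := by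
    rw [← neg_zero, ← integral_comp_neg_Ioi, neg_zero]
    refine setIntegral_congr_fun measurableSet_Ioi fun u hu => ?_
    simp only [abs_neg, abs_of_pos (Set.mem_Ioi.1 hu), neg_neg]
    congr 1
    simp only [gaussianPDFReal]
    congr 3
    ring
  rw [← intervalIntegral.integral_Iic_add_Ioi (b := 0) hi.integrableOn hi.integrableOn, hpos, hneg,
    integral_Ioi_exp_mul_gaussian _ _ hσ, integral_Ioi_exp_mul_gaussian _ _ hσ, laplaceGaussian]
  simp only [mul_neg, neg_neg, neg_div, sub_neg_eq_add]
  ring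

theorem laplaceGaussian_nonneg {l σ : ℝ} (hl : 0 ≤ l) (hσ : 0 < σ) (x : ℝ) :
    0 ≤ laplaceGaussian l σ x := by
  rw [← integral_exp_neg_abs_mul_gaussian hl hσ]
  exact integral_nonneg fun u => mul_nonneg (Real.exp_nonneg _) (gaussianPDFReal_nonneg _ _ _)

theorem integrable_exp_neg_mul_abs {l : ℝ} (hl : 0 < l) :
    Integrable fun u : ℝ => Real.exp (-(l * |u|)) := by
  have hp : IntegrableOn (fun u : ℝ => Real.exp (-(l * |u|))) (Set.Ioi 0) := by
    refine (integrableOn_congr_fun (fun u hu => ?_) measurableSet_Ioi).2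
      (exp_neg_integrableOn_Ioi 0 hl)
    simp only [abs_of_pos (Set.mem_Ioi.1 hu), neg_mul]
  have hn : IntegrableOn (fun u : ℝ => Real.exp (-(l * |u|))) (Set.Iic 0) := by
    refine (integrableOn_congr_fun (fun u hu => ?_) measurableSet_Iic).2
      (integrableOn_exp_mul_Iic hl 0)
    simp only [abs_of_nonpos (Set.mem_Iic.1 hu), mul_neg, neg_neg]
  rw [← integrableOn_univ, ← Set.Iic_union_Ioi (a := (0 : ℝ))]
  exact hn.union hp

theorem charFun_laplace {l : ℝ} (hl : 0 < l) (t : ℝ) :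
    charFun (volume.withDensity fun u => ENNReal.ofReal (Real.exp (-(l * |u|)))) t =
      ((2 * l / (l ^ 2 + t ^ 2) : ℝ) : ℂ) := by
  rw [charFun_withDensity_ofReal (by fun_prop) fun y => Real.exp_nonneg _]
  have hi := Integrable.mul_exp_I (integrable_exp_neg_mul_abs hl) t
  rw [← intervalIntegral.integral_Iic_add_Ioi (b := 0) hi.integrableOn hi.integrableOn]
  have hpos : ∫ u in Set.Ioi (0 : ℝ), ((Real.exp (-(l * |u|)) : ℝ) : ℂ) *
      Complex.exp (t * u * Complex.I) = ∫ u in Set.Ioi (0 : ℝ),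
      Complex.exp ((-l + t * Complex.I) * u) :=
    setIntegral_congr_fun measurableSet_Ioi fun u hu => by
      simp only [abs_of_pos (Set.mem_Ioi.1 hu), Complex.ofReal_exp, ← Complex.exp_add]
      congr 1; push_cast; ring
  have hneg : ∫ u in Set.Iic (0 : ℝ), ((Real.exp (-(l * |u|)) : ℝ) : ℂ) *
      Complex.exp (t * u * Complex.I) = ∫ u in Set.Iic (0 : ℝ),
      Complex.exp ((l + t * Complex.I) * u) :=
    setIntegral_congr_fun measurableSet_Iic fun u hu => by
      simp only [abs_of_nonpos (Set.mem_Iic.1 hu), Complex.ofReal_exp, ← Complex.exp_add]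
      congr 1; push_cast; ring
  rw [hpos, hneg, integral_exp_mul_complex_Ioi (by simpa using hl),
    integral_exp_mul_complex_Iic (by simpa using hl)]
  have h1 : (l : ℂ) + t * Complex.I ≠ 0 := fun h => hl.ne' (by simpa using congrArg Complex.re h)
  have h2 : -(l : ℂ) + t * Complex.I ≠ 0 := fun h => hl.ne' (by simpa using congrArg Complex.re h)
  have h3 : (l : ℂ) ^ 2 + t ^ 2 ≠ 0 := by
    have : l ^ 2 + t ^ 2 ≠ 0 := by positivity
    exact_mod_cast this
  simp only [Complex.ofReal_zero, mul_zero, Complex.exp_zero]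
  push_cast
  field_simp
  ring_nf
  simp only [Complex.I_sq]
  ring

theorem withDensity_laplaceGaussian {l σ : ℝ} (hl : 0 < l) (hσ : 0 < σ) :
    (volume.withDensity fun u => ENNReal.ofReal (Real.exp (-(l * |u|)))) ∗
        gaussianReal 0 (σ ^ 2 / 2).toNNReal =
      volume.withDensity fun y => ENNReal.ofReal (laplaceGaussian l σ y) := by
  have hv : (σ ^ 2 / 2).toNNReal ≠ 0 := by
    rw [Ne, Real.toNNReal_eq_zero, not_le]; positivity
  rw [gaussianReal_of_var_ne_zero _ hv, conv_withDensity_eq_lconvolution (by fun_prop)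
    (by fun_prop)]
  congr 1 with x
  rw [lconvolution_def, ← integral_exp_neg_abs_mul_gaussian hl.le hσ,
    ofReal_integral_eq_lintegral_ofReal (integrable_exp_neg_abs_mul_gaussian hl.le _ _)
      (.of_forall fun u => mul_nonneg (Real.exp_nonneg _) (gaussianPDFReal_nonneg _ _ _))]
  simp only [ENNReal.ofReal_mul (Real.exp_nonneg _), gaussianPDF]

theorem charFun_laplaceGaussian {l σ : ℝ} (hl : 0 < l) (hσ : 0 < σ) (t : ℝ) :
    ∫ y, (laplaceGaussian l σ y : ℂ) * Complex.exp (t * y * Complex.I) =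
      ((2 * l / (l ^ 2 + t ^ 2) * Real.exp (-(σ ^ 2 * t ^ 2 / 4)) : ℝ) : ℂ) := by
  have := isFiniteMeasure_withDensity_of_integrable (integrable_exp_neg_mul_abs hl)
  rw [← charFun_withDensity_ofReal (continuous_laplaceGaussian l σ).measurable
    (laplaceGaussian_nonneg hl.le hσ), ← withDensity_laplaceGaussian hl hσ, charFun_conv,
    charFun_laplace hl, charFun_gaussianReal, Real.coe_toNNReal _ (by positivity)]
  push_cast
  congr 2
  simp
  ring

/-- As a density it belongs to a convolution of two finite measures, so its total mass is finite. -/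
theorem integrable_laplaceGaussian {l σ : ℝ} (hl : 0 < l) (hσ : 0 < σ) :
    Integrable (laplaceGaussian l σ) := by
  have := isFiniteMeasure_withDensity_of_integrable (integrable_exp_neg_mul_abs hl)
  refine ⟨(continuous_laplaceGaussian l σ).aestronglyMeasurable, ?_⟩
  rw [hasFiniteIntegral_iff_ofReal (.of_forall (laplaceGaussian_nonneg hl.le hσ)),
    ← setLIntegral_univ, ← withDensity_apply _ .univ, ← withDensity_laplaceGaussian hl hσ]
  exact measure_lt_top _ _

/-! ### The circularly symmetric complex Gaussian law -/

theorem measurable_complex_mk : Measurable fun p : ℝ × ℝ => (⟨p.1, p.2⟩ : ℂ) :=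
  Complex.measurableEquivRealProd.symm.measurable

instance (σ : ℝ) : IsProbabilityMeasure (complexGaussian σ) :=
  Measure.isProbabilityMeasure_map measurable_complex_mk.aemeasurable

theorem charFun_complexGaussian (σ : ℝ) (z : ℂ) :
    charFun (complexGaussian σ) z = ((Real.exp (-(σ ^ 2 * ‖z‖ ^ 2 / 4)) : ℝ) : ℂ) := by
  have hpt : ∀ p : ℝ × ℝ, Complex.exp ((inner ℝ (⟨p.1, p.2⟩ : ℂ) z : ℝ) * Complex.I) =
      Complex.exp (z.re * p.1 * Complex.I) * Complex.exp (z.im * p.2 * Complex.I) := fun p => by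
    rw [← Complex.exp_add, Complex.inner]
    congr 1
    simp
    ring
  rw [charFun_apply, complexGaussian, integral_map measurable_complex_mk.aemeasurable (by fun_prop)]
  simp_rw [hpt]
  rw [integral_prod_mul (fun u : ℝ => Complex.exp (z.re * u * Complex.I))
    (fun u : ℝ => Complex.exp (z.im * u * Complex.I)), ← charFun_apply_real, ← charFun_apply_real,
    charFun_gaussianReal, charFun_gaussianReal, Real.coe_toNNReal _ (by positivity),
    ← Complex.exp_add, Complex.sq_norm, Complex.normSq_apply]
  push_cast
  congr 1
  ring

theorem integral_exp_neg_mul_sq_gaussianReal {v : ℝ≥0} {s : ℝ} (hs : 0 ≤ s) :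
    ∫ x, Real.exp (-(s * x ^ 2)) ∂gaussianReal 0 v = (√(1 + 2 * s * v))⁻¹ := by
  rcases eq_or_ne v 0 with rfl | hv
  · simp
  have hv' : (0 : ℝ) < v := by positivity
  rw [integral_gaussianReal_eq_integral_smul hv]
  have hpt : ∀ x : ℝ, gaussianPDFReal 0 v x • Real.exp (-(s * x ^ 2)) =
      (√(2 * Real.pi * v))⁻¹ * Real.exp (-((1 + 2 * s * v) / (2 * v)) * x ^ 2) := fun x => by
    rw [gaussianPDFReal, smul_eq_mul, mul_assoc, ← Real.exp_add]
    congr 2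
    field_simp
    ring
  simp_rw [hpt]
  rw [integral_const_mul, integral_gaussian, ← Real.sqrt_inv, ← Real.sqrt_inv, ← Real.sqrt_mul
    (by positivity)]
  congr 1
  field_simp

theorem integral_exp_neg_mul_normSq_complexGaussian (σ : ℝ) {s : ℝ} (hs : 0 ≤ s) :
    ∫ h, Real.exp (-(s * ‖h‖ ^ 2)) ∂complexGaussian σ = (1 + s * σ ^ 2)⁻¹ := by
  have hpt : ∀ p : ℝ × ℝ, Real.exp (-(s * ‖(⟨p.1, p.2⟩ : ℂ)‖ ^ 2)) =
      Real.exp (-(s * p.1 ^ 2)) * Real.exp (-(s * p.2 ^ 2)) := fun p => by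
    rw [← Real.exp_add, Complex.sq_norm, Complex.normSq_apply]
    congr 1
    ring
  rw [complexGaussian, integral_map measurable_complex_mk.aemeasurable (by fun_prop)]
  simp_rw [hpt]
  rw [integral_prod_mul (fun u : ℝ => Real.exp (-(s * u ^ 2)))
    (fun u : ℝ => Real.exp (-(s * u ^ 2))), integral_exp_neg_mul_sq_gaussianReal hs,
    Real.coe_toNNReal _ (by positivity), ← mul_inv, Real.mul_self_sqrt (by positivity)]
  ring

/-- The characteristic function of a product of independent complex Gaussians. -/
theorem integral_integral_exp_inner_mul (σ τ : ℝ) (z : ℂ) :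
    ∫ h, ∫ x, Complex.exp ((inner ℝ (h * x) z : ℝ) * Complex.I) ∂complexGaussian τ
        ∂complexGaussian σ =
      (((1 + (σ * τ / 2) ^ 2 * ‖z‖ ^ 2)⁻¹ : ℝ) : ℂ) := by
  have hpt : ∀ h : ℂ, ∫ x, Complex.exp ((inner ℝ (h * x) z : ℝ) * Complex.I) ∂complexGaussian τ =
      ((Real.exp (-(τ ^ 2 * ‖z‖ ^ 2 / 4 * ‖h‖ ^ 2)) : ℝ) : ℂ) := fun h => by
    -- The real adjoint of multiplication by `h` is multiplication by its conjugate, so the inner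
    -- integral is a Gaussian characteristic function.
    have hi : ∀ x : ℂ, inner ℝ (h * x) z = inner ℝ x (z * (starRingEnd ℂ) h) := fun x => by
      simp only [Complex.inner, map_mul, mul_assoc]
    simp_rw [hi]
    rw [← charFun_apply, charFun_complexGaussian, norm_mul, Complex.norm_conj]
    congr 3
    ring
  simp_rw [hpt]
  rw [integral_complex_ofReal,
    integral_exp_neg_mul_normSq_complexGaussian σ (by positivity)]
  congr 2
  ring

/-- The three independence assumptions make the joint law of all factors a product measure, under
which the exponential of the sum integrates to a product over `i`. -/
theorem charFun_map_sum_mul {Ω ι : Type*} [MeasurableSpace Ω] [Fintype ι] {P : Measure Ω}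
    [IsProbabilityMeasure P] {H X : ι → Ω → ℂ} {σ : ι → ℝ} {τ : ℝ}
    (mH : ∀ i, Measurable (H i)) (mX : ∀ i, Measurable (X i))
    (lH : ∀ i, HasLaw (H i) (complexGaussian (σ i)) P)
    (lX : ∀ i, HasLaw (X i) (complexGaussian τ) P)
    (iH : iIndepFun H P) (iX : iIndepFun X P)
    (iHX : IndepFun (fun ω i => H i ω) (fun ω i => X i ω) P) (z : ℂ) :
    charFun (P.map fun ω => ∑ i, H i ω * X i ω) z =
      ((∏ i, (1 + (σ i * τ / 2) ^ 2 * ‖z‖ ^ 2)⁻¹ : ℝ) : ℂ) := by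
  have hlaw : P.map (fun ω => ((fun i => H i ω), (fun i => X i ω))) =
      (Measure.pi fun i => complexGaussian (σ i)).prod
        (Measure.pi fun _ => complexGaussian τ) := by
    rw [(indepFun_iff_map_prod_eq_prod_map_map (by fun_prop) (by fun_prop)).1 iHX,
      (iIndepFun_iff_map_fun_eq_pi_map fun i => (mH i).aemeasurable).1 iH,
      (iIndepFun_iff_map_fun_eq_pi_map fun i => (mX i).aemeasurable).1 iX]
    simp only [(lH _).map_eq, (lX _).map_eq]
  have hmap : P.map (fun ω => ∑ i, H i ω * X i ω) =
      ((Measure.pi fun i => complexGaussian (σ i)).prod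
        (Measure.pi fun _ => complexGaussian τ)).map fun p => ∑ i, p.1 i * p.2 i := by
    rw [← hlaw, Measure.map_map (by fun_prop) (by fun_prop)]
    rfl
  have hpt : ∀ h x : ι → ℂ, Complex.exp ((inner ℝ (∑ i, h i * x i) z : ℝ) * Complex.I) =
      ∏ i, Complex.exp ((inner ℝ (h i * x i) z : ℝ) * Complex.I) := fun h x => by
    rw [← Complex.exp_sum, sum_inner, Complex.ofReal_sum, Finset.sum_mul]
  rw [hmap, charFun_apply, integral_map (by fun_prop) (by fun_prop), integral_prod]
  · simp only [hpt]
    have h1 : ∀ h : ι → ℂ, ∫ x : ι → ℂ,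
        ∏ i, Complex.exp ((inner ℝ (h i * x i) z : ℝ) * Complex.I)
          ∂(Measure.pi fun _ => complexGaussian τ) =
        ∏ i, ∫ x, Complex.exp ((inner ℝ (h i * x) z : ℝ) * Complex.I) ∂complexGaussian τ :=
      fun h => integral_fintype_prod_eq_prod
        (fun i x => Complex.exp ((inner ℝ (h i * x) z : ℝ) * Complex.I))
    simp_rw [h1]
    rw [integral_fintype_prod_eq_prod
      (fun i h => ∫ x, Complex.exp ((inner ℝ (h * x) z : ℝ) * Complex.I) ∂complexGaussian τ)]
    simp_rw [integral_integral_exp_inner_mul]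
    push_cast
    rfl
  · refine Integrable.of_bound (by fun_prop) 1 (.of_forall fun p => ?_)
    rw [Complex.norm_exp_ofReal_mul_I]

/-! ### The received samples -/

theorem charFun_map_inner {Ω : Type*} [MeasurableSpace Ω] {P : Measure Ω} {Y : Ω → ℂ}
    (hY : Measurable Y) (e : ℂ) (t : ℝ) :
    charFun (P.map fun ω => inner ℝ (Y ω) e) t = charFun (P.map Y) (t • e) := by
  rw [charFun_apply, charFun_apply, integral_map (by fun_prop) (by fun_prop),
    integral_map (by fun_prop) (by fun_prop)]
  simp only [real_inner_smul_right]
  simp [mul_comm]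

theorem Link.sent_of_neg {Ω : Type*} {nx nh : ℕ} (L : Link Ω nx nh) (nz : ℕ) {u : ℤ}
    (hu : u < 0) (ω : Ω) : L.sent nz u ω = 0 := by
  rw [Link.sent, if_neg (not_le.2 hu)]

theorem Link.sent_symbol {Ω : Type*} {nx nh : ℕ} (L : Link Ω nx nh) {nz : ℕ} {k : ℕ} (n : ℕ)
    (hk : k < nx + nz) (ω : Ω) :
    L.sent nz (n * ((nx + nz : ℕ) : ℤ) + k) ω = L.symbol n k ω := by
  rw [Link.sent, if_pos (by positivity)]
  have h1 : ((n : ℤ) * ((nx + nz : ℕ) : ℤ) + k) / ((nx + nz : ℕ) : ℤ) = n := by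
    rw [add_comm, Int.add_mul_ediv_right _ _ (by omega), Int.ediv_eq_zero_of_lt (by omega)
      (by exact_mod_cast hk), zero_add]
  have h2 : ((n : ℤ) * ((nx + nz : ℕ) : ℤ) + k) % ((nx + nz : ℕ) : ℤ) = k := by
    rw [add_comm, Int.add_mul_emod_self_right, Int.emod_eq_of_lt (by omega) (by exact_mod_cast hk)]
  rw [h1, h2]
  simp

/-- Within a guard interval at least as long as the channel memory there is no inter-symbol
interference. -/
theorem Link.sent_received {Ω : Type*} {nx nh : ℕ} (L : Link Ω nx nh) {nz m l : ℕ}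
    (hm : m < nx + nz) (hl : l < nz) (n : ℕ) (ω : Ω) :
    L.sent nz ((n : ℤ) * ((nx + nz : ℕ) : ℤ) + m + 0 - l) ω =
      if l ≤ m then L.symbol n (m - l) ω else 0 := by
  split_ifs with h
  · rw [← L.sent_symbol (nz := nz) n (k := m - l) (by omega)]
    congr 1
    push_cast [h]
    ring
  -- A time before the start of symbol `n` is either before the transmission (`n = 0`) or at
  -- position `nx + nz + m - l` of the previous symbol. As `l < nz`, this position is at least `nx`,
  -- hence in the padding.
  · rcases n with _ | n
    · exact L.sent_of_neg nz (by push_cast; omega) ω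
    · have hk : nx + nz + m - l < nx + nz := by omega
      have := L.sent_symbol n hk ω
      rw [Link.symbol, dif_neg (by omega)] at this
      rw [← this]
      congr 1
      rw [Nat.cast_sub (by omega)]
      push_cast
      ring

/-- The characteristic function of a channel output to which exactly the taps in `S` contribute,
tap `l` with the data sample `k l` of the symbol `n`. -/
theorem charFun_map_output {Ω : Type*} [MeasurableSpace Ω] {P : Measure Ω}
    [IsProbabilityMeasure P] {nx nh : ℕ} {σh : ℕ → ℝ} {σx σw : ℝ} {L : Link Ω nx nh}
    (hL : L.IsRayleigh P σh σx σw) {nz : ℕ} (u : ℤ) (n : ℕ)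
    (S : Finset (Fin nh)) (k : S → Fin nx) (hk : Function.Injective k)
    (hS : ∀ (l : S) ω, L.sent nz (u - ((l : Fin nh) : ℕ)) ω = L.x n (k l) ω)
    (hS' : ∀ l ∉ S, ∀ ω, L.sent nz (u - ((l : Fin nh) : ℕ)) ω = 0) :
    Measurable (L.output nz u) ∧ ∀ z, charFun (P.map (L.output nz u)) z =
      (((∏ l ∈ S, (1 + (σh l * σx / 2) ^ 2 * ‖z‖ ^ 2)⁻¹) *
        Real.exp (-(σw ^ 2 * ‖z‖ ^ 2 / 4)) : ℝ) : ℂ) := by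
  have mh := hL.measurable_h
  have mx := hL.measurable_x
  have mw := hL.measurable_w
  have hout : L.output nz u = fun ω => (∑ l : S, L.h u l ω * L.x n (k l) ω) + L.w u ω := by
    funext ω
    rw [Link.output]
    congr 1
    rw [← Finset.sum_subset (Finset.subset_univ S) fun l _ hl => by rw [hS' l hl, mul_zero],
      ← Finset.sum_coe_sort]
    exact Finset.sum_congr rfl fun l _ => by rw [hS]
  have hsig : Measurable fun ω => ∑ l : S, L.h u l ω * L.x n (k l) ω := by fun_prop
  have hind : IndepFun (fun ω => ∑ l : S, L.h u l ω * L.x n (k l) ω) (L.w u) P :=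
    hL.indep_signal_noise.comp
      (φ := fun p : (ℤ → Fin nh → ℂ) × (ℕ → Fin nx → ℂ) => ∑ l : S, p.1 u l * p.2 n (k l))
      (ψ := fun w : ℤ → ℂ => w u) (by fun_prop) (by fun_prop)
  refine ⟨by rw [hout]; fun_prop, fun z => ?_⟩
  rw [hout, hind.charFun_map_fun_add_eq_mul hsig.aemeasurable (mw u).aemeasurable, Pi.mul_apply,
    (hL.law_w u).map_eq, charFun_complexGaussian,
    charFun_map_sum_mul (H := fun l : S => L.h u l) (X := fun l => L.x n (k l))
      (σ := fun l => σh (l : Fin nh)) (fun l => mh u l) (fun l => mx n (k l))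
      (fun l => hL.law_h u l) (fun l => hL.law_x n (k l))
      ((hL.indep_taps u).precomp Subtype.val_injective)
      (hL.indep_samples.precomp (g := fun l : S => (n, k l)) fun a b h => hk (by simpa using h))
      (hL.indep_channel_data.comp
        (φ := fun (h : ℤ → Fin nh → ℂ) (l : S) => h u l)
        (ψ := fun (x : ℕ → Fin nx → ℂ) (l : S) => x n (k l)) (by fun_prop) (by fun_prop)),
    ← Complex.ofReal_mul, Finset.prod_coe_sort S (fun l => (1 + (σh l * σx / 2) ^ 2 * ‖z‖ ^ 2)⁻¹)]

/-! ### The two densities -/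

theorem hasDensity_noiseDensity {Ω : Type*} [MeasurableSpace Ω] {P : Measure Ω}
    [IsProbabilityMeasure P] {X : Ω → ℝ} (hX : Measurable X) {σ : ℝ} (hσ : 0 < σ)
    (h : ∀ t, charFun (P.map X) t = ((Real.exp (-(σ ^ 2 * t ^ 2 / 4)) : ℝ) : ℂ)) :
    HasDensity P X (noiseDensity σ) := by
  have hv : (σ ^ 2 / 2).toNNReal ≠ 0 := by
    rw [Ne, Real.toNNReal_eq_zero, not_le]; positivity
  have hpdf : noiseDensity σ = gaussianPDFReal 0 (σ ^ 2 / 2).toNNReal := by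
    funext y
    rw [noiseDensity, gaussianPDFReal, Real.coe_toNNReal _ (by positivity), one_div, sub_zero,
      neg_div]
    congr 3
    · ring_nf
    · field_simp
  have : IsProbabilityMeasure (P.map X) := Measure.isProbabilityMeasure_map hX.aemeasurable
  have hmap : P.map X = gaussianReal 0 (σ ^ 2 / 2).toNNReal := by
    refine Measure.ext_of_charFun (funext fun t => ?_)
    rw [h, charFun_gaussianReal, Real.coe_toNNReal _ (by positivity)]
    push_cast
    congr 1
    simp
    ring
  rw [hpdf]
  refine hasDensity_of_map_eq hX (by fun_prop) (gaussianPDFReal_nonneg _ _) ?_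
  rw [hmap, gaussianReal_of_var_ne_zero _ hv, gaussianPDF_def]

theorem signalDensity_neg (lam : ℕ → ℝ) (σ : ℝ) (a b : ℕ) (y : ℝ) :
    signalDensity lam σ a b (-y) = signalDensity lam σ a b y := by
  simp only [signalDensity, mul_neg, neg_neg, neg_div, sub_neg_eq_add, ← sub_eq_add_neg]
  simp only [add_comm]

/-- The weight of the rate `lam j` in the partial fraction decomposition of
`∏ i ∈ s, (1 + t ^ 2 / lam i ^ 2)⁻¹`, normalised for `laplaceGaussian (lam j)`. -/
noncomputable def laplaceWeight (lam : ℕ → ℝ) (s : Finset ℕ) (j : ℕ) : ℝ :=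
  (∏ i ∈ s, lam i) ^ 2 * (∏ k ∈ s.erase j, (lam k - lam j)⁻¹) * ∏ i ∈ s, (lam i + lam j)⁻¹

/-- For fixed `j`, the second sum of the closed form is the partial fraction expansion of `∏ i, (lam
i + x)⁻¹` at `x = lam j`. -/
theorem signalDensity_eq_sum {lam : ℕ → ℝ} {a b : ℕ} (hpos : ∀ i ∈ Finset.Icc a b, 0 < lam i)
    (hinj : Set.InjOn lam (Finset.Icc a b)) (σ y : ℝ) :
    signalDensity lam σ a b y =
      ∑ j ∈ Finset.Icc a b, laplaceWeight lam (Finset.Icc a b) j *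
        laplaceGaussian (lam j) σ y := by
  rw [signalDensity, Finset.mul_sum]
  refine Finset.sum_congr rfl fun j hj => ?_
  rw [laplaceWeight, prod_inv_add_eq_sum ⟨j, hj⟩ hinj fun i hi =>
    (add_pos (hpos i hi) (hpos j hj)).ne', Finset.mul_sum, Finset.mul_sum, Finset.sum_mul]
  refine Finset.sum_congr rfl fun r _ => ?_
  rw [laplaceGaussian, Finset.prod_inv_distrib, Finset.prod_inv_distrib, add_comm (lam r)]
  simp only [div_eq_mul_inv, one_mul]
  ring

theorem sum_laplaceWeight_mul {lam : ℕ → ℝ} {s : Finset ℕ} (hs : s.Nonempty)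
    (hpos : ∀ i ∈ s, 0 < lam i) (hinj : Set.InjOn lam s) (t : ℝ) :
    ∑ j ∈ s, laplaceWeight lam s j * (2 * lam j / (lam j ^ 2 + t ^ 2)) =
      ∏ i ∈ s, (1 + (lam i)⁻¹ ^ 2 * t ^ 2)⁻¹ := by
  have hsq : Set.InjOn (fun i => lam i ^ 2) s := fun i hi j hj h =>
    hinj hi hj ((pow_left_inj₀ (hpos i hi).le (hpos j hj).le two_ne_zero).1 h)
  have hr : ∏ i ∈ s, (1 + (lam i)⁻¹ ^ 2 * t ^ 2)⁻¹ =
      (∏ i ∈ s, lam i) ^ 2 * ∏ i ∈ s, (lam i ^ 2 + t ^ 2)⁻¹ := by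
    rw [← Finset.prod_pow, ← Finset.prod_mul_distrib]
    refine Finset.prod_congr rfl fun i hi => ?_
    have := hpos i hi
    field_simp
  rw [hr, prod_inv_add_eq_sum hs hsq fun i hi => by have := hpos i hi; positivity, Finset.mul_sum]
  refine Finset.sum_congr rfl fun j hj => ?_
  have hj0 := (hpos j hj).ne'
  have h2 : ∏ k ∈ s.erase j, (lam k ^ 2 - lam j ^ 2)⁻¹ =
      (∏ k ∈ s.erase j, (lam k - lam j)⁻¹) * ∏ k ∈ s.erase j, (lam k + lam j)⁻¹ := by
    rw [← Finset.prod_mul_distrib]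
    refine Finset.prod_congr rfl fun k _ => ?_
    rw [← mul_inv]
    congr 1
    ring
  -- The factor `i = j` of `∏ (lam i + lam j)⁻¹` is `(2 * lam j)⁻¹`; it cancels the numerator of the
  -- Laplace transform.
  rw [laplaceWeight, h2, ← Finset.mul_prod_erase s lam hj,
    ← Finset.mul_prod_erase s (fun i => (lam i + lam j)⁻¹) hj, ← two_mul]
  field_simp

theorem hasDensity_signalDensity {Ω : Type*} [MeasurableSpace Ω] {P : Measure Ω}
    [IsProbabilityMeasure P] {X : Ω → ℝ} (hX : Measurable X) {σ : ℝ} (hσ : 0 < σ) {lam : ℕ → ℝ}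
    {a b : ℕ} (hab : a ≤ b) (hpos : ∀ i ∈ Finset.Icc a b, 0 < lam i)
    (hinj : Set.InjOn lam (Finset.Icc a b))
    (h : ∀ t, charFun (P.map X) t = (((∏ i ∈ Finset.Icc a b, (1 + (lam i)⁻¹ ^ 2 * t ^ 2)⁻¹) *
      Real.exp (-(σ ^ 2 * t ^ 2 / 4)) : ℝ) : ℂ)) :
    HasDensity P X (signalDensity lam σ a b) := by
  have hsum := funext (signalDensity_eq_sum hpos hinj σ)
  have hc : Continuous (signalDensity lam σ a b) := by
    rw [hsum]
    exact continuous_finsetSum _ fun j _ => continuous_const.mul (continuous_laplaceGaussian _ _)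
  have hterm : ∀ j ∈ Finset.Icc a b, Integrable fun y =>
      laplaceWeight lam (Finset.Icc a b) j * laplaceGaussian (lam j) σ y := fun j hj =>
    (integrable_laplaceGaussian (hpos j hj) hσ).const_mul _
  have hi : Integrable (signalDensity lam σ a b) := by
    rw [hsum]
    exact integrable_finsetSum _ hterm
  have : IsProbabilityMeasure (P.map X) := Measure.isProbabilityMeasure_map hX.aemeasurable
  obtain ⟨h0, hmap⟩ := eq_withDensity_of_charFun_eq (μ := P.map X) hc hi fun t => by
    rw [h, hsum]
    simp only [Complex.ofReal_sum, Finset.sum_mul]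
    rw [integral_finsetSum _ fun j hj => Integrable.mul_exp_I (hterm j hj) t,
      ← sum_laplaceWeight_mul (Finset.nonempty_Icc.2 hab) hpos hinj, Finset.sum_mul,
      Complex.ofReal_sum]
    refine Finset.sum_congr rfl fun j hj => ?_
    simp_rw [Complex.ofReal_mul (laplaceWeight _ _ _), mul_assoc (laplaceWeight _ _ _ : ℂ)]
    rw [integral_const_mul, charFun_laplaceGaussian (hpos j hj) hσ, mul_assoc, Complex.ofReal_mul]
  exact hasDensity_of_map_eq hX hc.measurable h0 hmap

theorem re_eq_inner (z : ℂ) : z.re = inner ℝ z 1 := by simp [Complex.inner]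

theorem im_eq_inner (z : ℂ) : z.im = inner ℝ z Complex.I := by simp [Complex.inner]

/-- A rotation invariant characteristic function is the characteristic function of the in-phase and
of the quadrature component. -/
theorem re_im_of_charFun_map {Ω : Type*} [MeasurableSpace Ω] {P : Measure Ω} {Y : Ω → ℂ}
    (hY : Measurable Y) {φ : ℝ → ℂ} (h : ∀ z, charFun (P.map Y) z = φ (‖z‖ ^ 2))
    {Q : (Ω → ℝ) → Prop}
    (hQ : ∀ X : Ω → ℝ, Measurable X → (∀ t, charFun (P.map X) t = φ (t ^ 2)) → Q X) :
    Q (fun ω => (Y ω).re) ∧ Q (fun ω => (Y ω).im) := by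
  constructor
  · refine hQ _ (by fun_prop) fun t => ?_
    simp_rw [re_eq_inner]
    rw [charFun_map_inner hY, h]
    simp
  · refine hQ _ (by fun_prop) fun t => ?_
    simp_rw [im_eq_inner]
    rw [charFun_map_inner hY, h]
    simp

end ZPOFDM

theorem theorem2 {Ω : Type*} [MeasurableSpace Ω] (P : Measure Ω) [IsProbabilityMeasure P]
    (nx nz nh : ℕ) (hnx : 1 ≤ nx) (hnh : 1 ≤ nh) (hnz : nh ≤ nz)
    (σh : ℕ → ℝ) (σx σw : ℝ) (hσh : ∀ l < nh, 0 < σh l) (hσx : 0 < σx) (hσw : 0 < σw)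
    (L : ZPOFDM.Link Ω nx nh) (hL : L.IsRayleigh P σh σx σw) :
    (∀ (n : ℤ) (m : ℕ), m < nx + nz → (n < 0 ∨ nx + nh - 1 ≤ m) →
      ZPOFDM.HasDensity P (fun ω => (L.received nz 0 n m ω).re) (ZPOFDM.noiseDensity σw) ∧
      ZPOFDM.HasDensity P (fun ω => (L.received nz 0 n m ω).im) (ZPOFDM.noiseDensity σw)) ∧
    (∀ (n : ℤ) (m : ℕ), 0 ≤ n → m + 2 ≤ nx + nh →
      Set.InjOn σh (Set.Icc (ZPOFDM.firstTap nx m) (ZPOFDM.lastTap nh m)) →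
      (∀ y, ZPOFDM.signalDensity (ZPOFDM.rate σh σx) σw
          (ZPOFDM.firstTap nx m) (ZPOFDM.lastTap nh m) (-y) =
        ZPOFDM.signalDensity (ZPOFDM.rate σh σx) σw
          (ZPOFDM.firstTap nx m) (ZPOFDM.lastTap nh m) y) ∧
      ZPOFDM.HasDensity P (fun ω => (L.received nz 0 n m ω).re)
        (ZPOFDM.signalDensity (ZPOFDM.rate σh σx) σw
          (ZPOFDM.firstTap nx m) (ZPOFDM.lastTap nh m)) ∧
      ZPOFDM.HasDensity P (fun ω => (L.received nz 0 n m ω).im)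
        (ZPOFDM.signalDensity (ZPOFDM.rate σh σx) σw
          (ZPOFDM.firstTap nx m) (ZPOFDM.lastTap nh m))) := by
  open ZPOFDM in
  constructor
  · intro n m hm hnm
    -- For `n < 0` all times involved are negative; otherwise `l ≤ nh - 1` forces `m - l ≥ nx`,
    -- which is padding.
    have hzero : ∀ (l : Fin nh) ω,
        L.sent nz (n * ((nx + nz : ℕ) : ℤ) + m + 0 - (l : ℕ)) ω = 0 := fun l ω => by
      rcases lt_or_ge n 0 with hn | hn
      · refine L.sent_of_neg nz ?_ ω
        have : n * ((nx + nz : ℕ) : ℤ) ≤ -1 * ((nx + nz : ℕ) : ℤ) :=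
          mul_le_mul_of_nonneg_right (by omega) (by positivity)
        omega
      · lift n to ℕ using hn
        have hnm' : nx + nh - 1 ≤ m := hnm.resolve_left (by omega)
        rw [L.sent_received hm (l.2.trans_le hnz)]
        split_ifs
        · rw [Link.symbol, dif_neg (by omega)]
        · rfl
    -- With no contributing tap, the symbol index `0` and the sample `⟨0, hnx⟩` are placeholders.
    obtain ⟨hY, hchar⟩ := charFun_map_output hL (nz := nz) (n * ((nx + nz : ℕ) : ℤ) + m + 0) 0 ∅
      (fun _ => ⟨0, hnx⟩) (fun a => isEmptyElim a) (fun l => isEmptyElim l)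
      fun l _ ω => hzero l ω
    exact re_im_of_charFun_map (Y := L.received nz 0 n m) hY
      (φ := fun r => ((Real.exp (-(σw ^ 2 * r / 4)) : ℝ) : ℂ))
      (fun z => (hchar z).trans (by simp))
      fun X hX hφ => hasDensity_noiseDensity hX hσw hφ
  · intro n m hn hm hinj
    refine ⟨signalDensity_neg _ _ _ _, ?_⟩
    lift n to ℕ using hn
    have hab : firstTap nx m ≤ lastTap nh m := by
      unfold firstTap lastTap; split_ifs <;> omega
    -- The interval from `a` to `b` consists exactly of the taps that meet a data sample.
    have hmem : ∀ l, l ∈ Finset.Icc (firstTap nx m) (lastTap nh m) ↔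
        l < nh ∧ l ≤ m ∧ m - l < nx := fun l => by
      rw [Finset.mem_Icc]
      unfold firstTap lastTap; split_ifs <;> omega
    have hsent : ∀ (l : Fin nh) ω,
        L.sent nz ((n : ℤ) * ((nx + nz : ℕ) : ℤ) + m + 0 - (l : ℕ)) ω =
          if (l : ℕ) ≤ m then L.symbol n (m - l) ω else 0 := fun l ω =>
      L.sent_received (by omega) (l.2.trans_le hnz) n ω
    let S : Finset (Fin nh) := {l | (l : ℕ) ≤ m ∧ m - l < nx}
    have hS : ∀ l : S, ((l : Fin nh) : ℕ) ≤ m ∧ m - (l : Fin nh) < nx := fun l =>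
      (Finset.mem_filter.1 l.2).2
    obtain ⟨hY, hchar⟩ := charFun_map_output hL (nz := nz)
      ((n : ℤ) * ((nx + nz : ℕ) : ℤ) + m + 0) n S (fun l => ⟨m - (l : Fin nh), (hS l).2⟩)
      (fun i j hij => by
        have := (hS i).1
        have := (hS j).1
        have := congrArg Fin.val hij
        simp only at this
        exact Subtype.ext (Fin.ext (by omega)))
      (fun l ω => by rw [hsent, if_pos (hS l).1, Link.symbol, dif_pos (hS l).2])
      (fun l hl ω => by
        rw [hsent]
        split_ifs with h
        · rw [Link.symbol, dif_neg fun h' => hl (Finset.mem_filter.2 ⟨Finset.mem_univ _, h, h'⟩)]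
        · rfl)
    have hprod : ∀ r : ℝ, ∏ l ∈ S, (1 + (σh l * σx / 2) ^ 2 * r)⁻¹ =
        ∏ i ∈ Finset.Icc (firstTap nx m) (lastTap nh m),
          (1 + (rate σh σx i)⁻¹ ^ 2 * r)⁻¹ := fun r => by
      refine Finset.prod_bij (fun l _ => (l : ℕ)) (fun l hl => ?_) (fun i _ j _ h => Fin.ext h)
        (fun i hi => ?_) fun l _ => ?_
      · exact (hmem l).2 ⟨l.2, (Finset.mem_filter.1 hl).2⟩
      · obtain ⟨h1, h2⟩ := (hmem i).1 hi
        exact ⟨⟨i, h1⟩, Finset.mem_filter.2 ⟨Finset.mem_univ _, h2⟩, rfl⟩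
      · rw [rate, inv_div]
    refine re_im_of_charFun_map (Y := L.received nz 0 n m) hY
      (φ := fun r => (((∏ i ∈ Finset.Icc (firstTap nx m) (lastTap nh m),
        (1 + (rate σh σx i)⁻¹ ^ 2 * r)⁻¹) * Real.exp (-(σw ^ 2 * r / 4)) : ℝ) : ℂ))
      (fun z => (hchar z).trans (by rw [hprod]))
      fun X hX hφ => hasDensity_signalDensity hX hσw hab (fun i hi => ?_) (fun i hi j hj h => ?_) hφ
    · have := hσh i ((hmem i).1 hi).1
      unfold rate
      positivity
    · have h1 := hσh i ((hmem i).1 hi).1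
      have h2 := hσh j ((hmem j).1 hj).1
      -- With `σx` fixed, equal rates mean equal `σh`, so distinct tap deviations give distinct
      -- rates.
      refine hinj (by simpa using hi) (by simpa using hj) ?_
      unfold rate at h
      field_simp at h
      linarith
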